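/- Let $K$ be a field. Arithmetic circuits over $K$ are finite acyclic graphs of gates: input gates carry variables or constants of $K$, and the arithmetic gates are unweighted addition and multiplication gates; the size is the number of all gates, inputs included. A formula is a circuit in which every gate other than the output has fan-out one. A depth-four circuit is a $\Sigma\Pi\Sigma\Pi$ circuit: the gates are arranged in levels $0,\dots,4$, wires go from each level to the next one, the inputs are at level $0$, the gates at levels $2$ and $4$ (the output) are addition gates and those at levels $1$ and $3$ are multiplication gates, of unbounded fan-in unless specified. A family $(f_n)$ of polynomials over $K$ is in VP if there is a polynomial $p$ such that, for every $n$, $\deg f_n\le p(n)$ and $f_n$ is computed by an arithmetic circuit with gates of fan-in at most two of size at most $p(n)$. Theorem. Let $(f_n)$ be a VP family and let $d_n=\deg(f_n)$ be the total degree (with $\deg 0=0$ and the convention $\log 0=0$). 1. There is a family $(\Gamma_n)$ of depth-four circuits such that, for every $n$, $\Gamma_n$ computes $f_n$, its inputs are variables occurring in $f_n$ or constants of $K$ (each input gate having fan-out at most one), and its multiplication gates have fan-in at most $\sqrt{3d_n}+1$; and there is a constant $c$ such that for all $n\ge 2$ the circuit $\Gamma_n$ has at most $n^{c(1+\log d_n)}$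 addition gates and at most $n^{c(1+\sqrt{d_n}\log d_n)}$ multiplication gates. 2. There is a family $(F_n)$ of depth-four formulas such that, for every $n$, $F_n$ computes $f_n$, its inputs are variables occurring in $f_n$ or constants of $K$, and its multiplication gates have fan-in at most $\sqrt{3d_n}+1$; and there is a constant $c$ such that for all $n\ge 2$ the size of $F_n$ is at most $n^{c(1+\sqrt{d_n}\log d_n)}$. 3. In particular, if the permanents of the $n\times n$ matrices of indeterminates over $K$ are computed by arithmetic circuits (of fan-in at most two) of size polynomial in $n$, then they are computed by depth-four formulas whose size is, for some constant $c$ and all $n\ge 2$, at most $n^{c\sqrt n\log n}$. -/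

import Mathlib

universe u v

/-- What a gate of an arithmetic circuit does: an input gate carries a variable `x : σ` or a
constant `c : K`; an addition (resp. multiplication) gate computes the unweighted sum
(resp. product) of the gates of `G` wired into it.  Wires form a multiset, so that the fan-in is
arbitrary and the same gate may be wired in several times (as in `g * g`). -/
inductive GateOp (K : Type u) (σ : Type v) (G : Type) : Type (max u v)
  | var (x : σ)
  | const (c : K)
  | add (s : Multiset G)
  | mul (s : Multiset G)

namespace GateOp

variable {K : Type u} {σ : Type v} {G : Type}

/-- The gates wired into a gate, with multiplicity. -/
def children : GateOp K σ G → Multiset G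
  | var _ => 0
  | const _ => 0
  | add s => s
  | mul s => s

/-- Input gates: variables and constants. -/
def IsInput : GateOp K σ G → Prop
  | var _ => True
  | const _ => True
  | add _ => False
  | mul _ => False

/-- Addition gates. -/
def IsAdd : GateOp K σ G → Prop
  | add _ => True
  | _ => False

/-- Multiplication gates. -/
def IsMul : GateOp K σ G → Prop
  | mul _ => True
  | _ => False

end GateOp

/-- An arithmetic circuit over `K` with variables from `σ`: a finite acyclic directed graph of
gates, with a distinguished output gate. -/
structure ArithCircuit (K : Type u) (σ : Type v) : Type (max u v 1) where
  /-- The gates, including the input gates. -/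
  Gate : Type
  [fintypeGate : Fintype Gate]
  /-- What each gate does. -/
  op : Gate → GateOp K σ Gate
  /-- The wiring is acyclic. -/
  acyclic : WellFounded fun a b : Gate => a ∈ (op b).children
  /-- The output gate. -/
  out : Gate

namespace ArithCircuit

attribute [instance] ArithCircuit.fintypeGate

variable {K : Type u} {σ : Type v}

section Eval

variable [CommSemiring K]

/-- The polynomial computed by a gate from the polynomials computed by its children. -/
noncomputable def evalStep {G : Type} (o : GateOp K σ G)
    (ih : ∀ a, a ∈ o.children → MvPolynomial σ K) : MvPolynomial σ K :=
  match o, ih with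
  | .var x, _ => MvPolynomial.X x
  | .const c, _ => MvPolynomial.C c
  | .add s, ih => (s.attach.map fun a => ih a.1 a.2).sum
  | .mul s, ih => (s.attach.map fun a => ih a.1 a.2).prod

/-- The polynomial computed by a gate. -/
noncomputable def eval (C : ArithCircuit K σ) : C.Gate → MvPolynomial σ K :=
  C.acyclic.fix fun g ih => evalStep (C.op g) ih

theorem eval_eq (C : ArithCircuit K σ) (g : C.Gate) :
    C.eval g = match C.op g with
      | .var x => MvPolynomial.X x
      | .const c => MvPolynomial.C c
      | .add s => (s.map C.eval).sum
      | .mul s => (s.map C.eval).prod := by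
  have h : C.eval g = evalStep (C.op g) fun a _ => C.eval a := by
    unfold eval
    rw [WellFounded.fix_eq]
  rw [h]
  cases C.op g <;> simp [evalStep, Multiset.attach_map_val']

/-- The circuit computes the polynomial `f` at its output gate. -/
def Computes (C : ArithCircuit K σ) (f : MvPolynomial σ K) : Prop :=
  C.eval C.out = f

end Eval

/-- The size of a circuit: the total number of its gates, including the input gates. -/
def size (C : ArithCircuit K σ) : ℕ := Fintype.card C.Gate

/-- The number of addition gates. -/
noncomputable def numAdd (C : ArithCircuit K σ) : ℕ := {g | (C.op g).IsAdd}.ncard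

/-- The number of multiplication gates. -/
noncomputable def numMul (C : ArithCircuit K σ) : ℕ := {g | (C.op g).IsMul}.ncard

/-- The fan-in of a gate. -/
def fanIn (C : ArithCircuit K σ) (g : C.Gate) : ℕ := Multiset.card (C.op g).children

open Classical in
/-- The fan-out of a gate: the number of wires leaving it. -/
noncomputable def fanOut (C : ArithCircuit K σ) (g : C.Gate) : ℕ :=
  ∑ b, (C.op b).children.count g

/-- All gates have fan-in at most two. -/
def IsBinary (C : ArithCircuit K σ) : Prop := ∀ g, C.fanIn g ≤ 2

/-- Every input gate has fan-out at most one. -/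
def InputsUnshared (C : ArithCircuit K σ) : Prop :=
  ∀ g, (C.op g).IsInput → C.fanOut g ≤ 1

/-- An arithmetic formula: every gate except the output gate has fan-out one (and the output gate
has fan-out zero). -/
def IsFormula (C : ArithCircuit K σ) : Prop :=
  C.fanOut C.out = 0 ∧ ∀ g, g ≠ C.out → C.fanOut g = 1

/-- A depth four (`ΣΠΣΠ`) circuit: the gates are arranged in levels, wires go from each level to
the next one, the inputs are at level `0`, the output gate is at level `4`, the gates at levels
`4` and `2` are addition gates, and the gates at levels `3` and `1` are multiplication gates.
Every arithmetic gate has at least one input, so the level of a gate is its depth. -/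
def IsDepthFour (C : ArithCircuit K σ) : Prop :=
  ∃ level : C.Gate → ℕ,
    level C.out = 4 ∧
    (∀ g, (C.op g).IsInput → level g = 0) ∧
    (∀ g, (C.op g).IsAdd → level g = 2 ∨ level g = 4) ∧
    (∀ g, (C.op g).IsMul → level g = 1 ∨ level g = 3) ∧
    (∀ g, ¬ (C.op g).IsInput → (C.op g).children ≠ 0) ∧
    (∀ g, ∀ a ∈ (C.op g).children, level g = level a + 1)

/-- All variables at the input gates belong to `S` (the other inputs are constants). -/
def VarsIn (C : ArithCircuit K σ) (S : Set σ) : Prop :=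
  ∀ g x, C.op g = GateOp.var x → x ∈ S

/-- All multiplication gates have fan-in at most `B`. -/
def MulFanInLE (C : ArithCircuit K σ) (B : ℝ) : Prop :=
  ∀ g, (C.op g).IsMul → (C.fanIn g : ℝ) ≤ B

end ArithCircuit

/-- The family `f` is computed by arithmetic circuits of size polynomial in `n`
(with unweighted gates of fan-in at most two). -/
def HasPolySizeCircuits {K : Type u} [Field K] {σ : ℕ → Type v}
    (f : ∀ n, MvPolynomial (σ n) K) : Prop :=
  ∃ p : Polynomial ℕ, ∀ n, ∃ C : ArithCircuit K (σ n),
    C.IsBinary ∧ C.Computes (f n) ∧ C.size ≤ p.eval n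

/-- The class `VP` over the field `K`: polynomially bounded degree and circuit size. -/
def IsVP {K : Type u} [Field K] {σ : ℕ → Type v} (f : ∀ n, MvPolynomial (σ n) K) : Prop :=
  (∃ p : Polynomial ℕ, ∀ n, (f n).totalDegree ≤ p.eval n) ∧ HasPolySizeCircuits f

/-- The permanent of the `n × n` matrix of indeterminates. -/
noncomputable def permanentPoly (K : Type u) [Field K] (n : ℕ) :
    MvPolynomial (Fin n × Fin n) K :=
  Matrix.permanent (Matrix.of fun i j => MvPolynomial.X (i, j))

/-! Split the polynomial at each gate of the given circuit into homogeneous components. Fix a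
threshold `m ≥ 2`. Descending from a component of degree at least `m`, through the sums at addition
gates and the convolutions at multiplication gates, one always meets a product of two components of
degree below `m` whose product has degree at least `m`. Collecting terms by such pairs writes a
component of degree `i` as `∑ Q w * (p * q)` with `deg Q w ≤ i - m` (`hasFrontier_comp`).

Take `m = i - t + 1`. Then `Q w` has degree below `t`, while `p` and `q` have degrees `j, l ≤ i - t`
with `j + l ≤ i`. Recursing on factors of degree above `t` yields products of at most `3i/t - 1`
polynomials of degree at most `t` (`comp_mem_pow`). With `t = ⌊√(3d)⌋` this is at most `t + 1`,
which balances the number of factors against their degree. All factors come from one polynomially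
large family, consisting of `0`, `1`, components, products of two components, and coefficients `Q w`
(`exists_family`). The `Q w` need no small circuits, since every member is simply expanded into
monomials.

So `f` is a sum of `(t + 1)`-fold products from `N` polynomials of degree at most `t` in the
variables of `f` (`exists_decomposition`), which is a `ΣΠΣΠ` expression. Sharing the `N` inner sums
gives the circuit with few addition gates; copying them gives the formula. The counts are `n` to the
power `O(t + 1)`, and `t + 1 ≤ 4(1 + √d log d)`. -/

/-! ### Frontier decomposition of homogeneous components. -/

section Frontier

open MvPolynomial

namespace ArithCircuit

variable {K : Type u} {σ : Type v} [CommSemiring K]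

/-- The homogeneous component of degree `i` of the polynomial computed by the gate `g`. -/
noncomputable def comp (C : ArithCircuit K σ) (g : C.Gate) (i : ℕ) : MvPolynomial σ K :=
  homogeneousComponent i (C.eval g)

theorem comp_isHomogeneous (C : ArithCircuit K σ) (g : C.Gate) (i : ℕ) :
    (C.comp g i).IsHomogeneous i :=
  homogeneousComponent_isHomogeneous i _

theorem totalDegree_comp_le (C : ArithCircuit K σ) (g : C.Gate) (i : ℕ) :
    (C.comp g i).totalDegree ≤ i :=
  (C.comp_isHomogeneous g i).totalDegree_le

end ArithCircuit

/-- Compared coefficientwise: a splitting of an exponent of degree `i` contributes only to the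
summand indexed by the degrees of its two parts. -/
theorem MvPolynomial.homogeneousComponent_mul_eq_sum {K : Type u} {σ : Type v} [CommSemiring K]
    (p q : MvPolynomial σ K) (i : ℕ) :
    homogeneousComponent i (p * q) =
      ∑ jk ∈ Finset.HasAntidiagonal.antidiagonal i,
        homogeneousComponent jk.1 p * homogeneousComponent jk.2 q := by
  classical
  ext m
  rw [coeff_homogeneousComponent, coeff_mul, coeff_sum]
  simp only [coeff_mul, coeff_homogeneousComponent]
  rw [Finset.sum_comm]
  by_cases h : m.degree = i
  · rw [if_pos h]
    refine Finset.sum_congr rfl fun x hx => ?_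
    rw [Finset.HasAntidiagonal.mem_antidiagonal] at hx
    rw [Finset.sum_eq_single (x.1.degree, x.2.degree)]
    · simp
    · rintro ⟨a, b⟩ - hab
      by_cases h1 : x.1.degree = a
      · by_cases h2 : x.2.degree = b
        · exact absurd (by rw [h1, h2]) hab
        · simp [h2]
      · simp [h1]
    · intro hn
      exact absurd (by rw [Finset.HasAntidiagonal.mem_antidiagonal, ← h, ← hx, map_add]) hn
  · rw [if_neg h]
    refine (Finset.sum_eq_zero fun x hx => Finset.sum_eq_zero fun y hy => ?_).symm
    rw [Finset.HasAntidiagonal.mem_antidiagonal] at hx hy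
    by_cases h1 : x.1.degree = y.1
    · by_cases h2 : x.2.degree = y.2
      · exact absurd (by rw [← hy, ← hx, map_add, h1, h2]) h
      · simp [h2]
    · simp [h1]

namespace ArithCircuit

variable {K : Type u} {σ : Type v} [CommSemiring K]

/-- The index set of the homogeneous components of degree less than `n` of the gates. -/
abbrev Part (C : ArithCircuit K σ) (n : ℕ) : Type := C.Gate × Fin n

/-- The homogeneous component indexed by an element of `C.Part n`. -/
noncomputable def part (C : ArithCircuit K σ) {n : ℕ} (a : C.Part n) : MvPolynomial σ K :=
  C.comp a.1 a.2

/-- The polynomial `p` is a combination of products of two homogeneous components of gates, the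
two factors having degree less than `m` and the product having degree at least `m`, with
coefficients such that no term has degree more than `i`. -/
def HasFrontier (C : ArithCircuit K σ) (n m i : ℕ) (p : MvPolynomial σ K) : Prop :=
  ∃ Q : C.Part n × C.Part n → MvPolynomial σ K,
    (∀ w, Q w = 0 ∨ ((w.1.2 : ℕ) < m ∧ (w.2.2 : ℕ) < m ∧ m ≤ w.1.2 + w.2.2 ∧
      (Q w).totalDegree + w.1.2 + w.2.2 ≤ i)) ∧
    p = ∑ w, Q w * (C.part w.1 * C.part w.2)

theorem HasFrontier.zero (C : ArithCircuit K σ) (n m i : ℕ) : C.HasFrontier n m i 0 :=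
  ⟨fun _ => 0, fun _ => Or.inl rfl, by simp⟩

theorem HasFrontier.add {C : ArithCircuit K σ} {n m i : ℕ} {p q : MvPolynomial σ K}
    (hp : C.HasFrontier n m i p) (hq : C.HasFrontier n m i q) : C.HasFrontier n m i (p + q) := by
  obtain ⟨P, hP, rfl⟩ := hp
  obtain ⟨Q, hQ, rfl⟩ := hq
  refine ⟨fun w => P w + Q w, fun w => ?_, by simp [add_mul, Finset.sum_add_distrib]⟩
  rcases hP w with h | h
  · rcases hQ w with h' | h'
    · exact Or.inl (by simp [h, h'])
    · exact Or.inr (by simpa [h] using h')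
  · rcases hQ w with h' | h'
    · exact Or.inr (by simpa [h'] using h)
    · have := totalDegree_add (P w) (Q w)
      rcases le_max_iff.1 this with h1 | h1 <;> exact Or.inr ⟨h.1, h.2.1, h.2.2.1, by dsimp only; omega⟩

theorem HasFrontier.sum {C : ArithCircuit K σ} {n m i : ℕ} {ι : Type*} (s : Finset ι)
    (p : ι → MvPolynomial σ K) (h : ∀ a ∈ s, C.HasFrontier n m i (p a)) :
    C.HasFrontier n m i (∑ a ∈ s, p a) :=
  Finset.sum_induction p (C.HasFrontier n m i) (fun _ _ => HasFrontier.add) (.zero C n m i) h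

theorem HasFrontier.mul_left {C : ArithCircuit K σ} {n m i k : ℕ} {p q : MvPolynomial σ K}
    (hq : q.totalDegree ≤ k) (hp : C.HasFrontier n m i p) :
    C.HasFrontier n m (k + i) (q * p) := by
  obtain ⟨P, hP, rfl⟩ := hp
  refine ⟨fun w => q * P w, fun w => ?_, by simp [Finset.mul_sum, mul_assoc]⟩
  rcases hP w with h | h
  · exact Or.inl (by simp [h])
  · have := totalDegree_mul q (P w)
    exact Or.inr ⟨h.1, h.2.1, h.2.2.1, by dsimp only; omega⟩

theorem HasFrontier.comp_mul_comp (C : ArithCircuit K σ) {n m j k : ℕ} (a b : C.Gate)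
    (hmn : m ≤ n) (hj : j < m) (hk : k < m) (hjk : m ≤ j + k) :
    C.HasFrontier n m (j + k) (C.comp a j * C.comp b k) := by
  classical
  let w₀ : C.Part n × C.Part n := ((a, ⟨j, by omega⟩), (b, ⟨k, by omega⟩))
  refine ⟨fun w => if w = w₀ then 1 else 0, fun w => ?_, ?_⟩
  · by_cases h : w = w₀
    · subst h
      exact Or.inr ⟨hj, hk, hjk, by simp [w₀]⟩
    · exact Or.inl (if_neg h)
  · rw [Finset.sum_eq_single w₀ (fun w _ hw => by simp [hw]) (by simp)]
    simp [w₀, part]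

/-- Every homogeneous component of degree at least `m` is a combination of the products of
components at which the degree passes `m`. -/
theorem hasFrontier_comp (C : ArithCircuit K σ) (hC : C.IsBinary) {n m : ℕ} (hm : 2 ≤ m)
    (hmn : m ≤ n) (g : C.Gate) : ∀ i, m ≤ i → C.HasFrontier n m i (C.comp g i) := by
  induction g using C.acyclic.induction with
  | _ g ih =>
  intro i hi
  have hbin := hC g
  have heval := C.eval_eq g
  unfold fanIn at hbin
  unfold comp
  rw [heval]
  cases hop : C.op g with
  | var x =>
    -- Inputs have degree at most `1`, hence no component of degree `m ≥ 2`.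
    rw [homogeneousComponent_of_mem (isHomogeneous_X K x), if_neg (by omega)]
    exact .zero C n m i
  | const c =>
    rw [homogeneousComponent_of_mem (isHomogeneous_C σ c), if_neg (by omega)]
    exact .zero C n m i
  | add s =>
    dsimp only
    rw [hop] at ih
    have ih' : ∀ a ∈ s, ∀ i, m ≤ i → C.HasFrontier n m i (C.comp a i) := ih
    clear ih hop heval hbin
    induction s using Multiset.induction with
    | empty => simpa using HasFrontier.zero C n m i
    | cons a s ihs =>
      rw [Multiset.map_cons, Multiset.sum_cons, map_add]
      exact (ih' a (by simp) i hi).add (ihs fun b hb => ih' b (by simp [hb]))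
  | mul s =>
    dsimp only
    rw [hop] at ih hbin
    have ih' : ∀ a ∈ s, ∀ i, m ≤ i → C.HasFrontier n m i (C.comp a i) := ih
    have hcard : Multiset.card s ≤ 2 := hbin
    interval_cases hs : Multiset.card s
    · rw [Multiset.card_eq_zero] at hs
      subst hs
      rw [Multiset.map_zero, Multiset.prod_zero,
        homogeneousComponent_of_mem (isHomogeneous_one σ K), if_neg (by omega)]
      exact .zero C n m i
    · obtain ⟨a, rfl⟩ := Multiset.card_eq_one.1 hs
      rw [Multiset.map_singleton, Multiset.prod_singleton]
      exact ih' a (by simp) i hi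
    · obtain ⟨a, b, rfl⟩ := Multiset.card_eq_two.1 hs
      have hab : (Multiset.map C.eval {a, b}).prod = C.eval a * C.eval b := by simp
      rw [hab, homogeneousComponent_mul_eq_sum]
      refine HasFrontier.sum _ _ ?_
      rintro ⟨j, k⟩ hjk
      rw [Finset.HasAntidiagonal.mem_antidiagonal] at hjk
      dsimp only at hjk ⊢
      change C.HasFrontier n m i (C.comp a j * C.comp b k)
      subst hjk
      -- Descend into a factor still of degree at least `m`, moving the other factor into the
      -- coefficient; if both are below `m`, the pair itself lies on the frontier.
      by_cases hk : m ≤ k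
      · exact (ih' b (by simp) k hk).mul_left (C.totalDegree_comp_le a j)
      · by_cases hj : m ≤ j
        · rw [mul_comm, add_comm]
          exact (ih' a (by simp) j hj).mul_left (C.totalDegree_comp_le b k)
        · exact .comp_mul_comp C a b hmn (by omega) (by omega) hi

end ArithCircuit

end Frontier

/-! ### Components as short products from a family of low-degree polynomials. -/

section Family

open MvPolynomial
open scoped Pointwise

/-- Products are padded with factors `1`, so all can be brought to a common length. -/
theorem AddSubmonoid.mem_pow_of_le {R : Type*} [Semiring R] {A : AddSubmonoid R}
    (h1 : (1 : R) ∈ A) {a b : ℕ} (hab : a ≤ b) {x : R} (hx : x ∈ A ^ a) : x ∈ A ^ b := by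
  induction b, hab using Nat.le_induction with
  | base => exact hx
  | succ b _ ih =>
    rw [pow_succ]
    simpa using AddSubmonoid.mul_mem_mul ih h1

/-- The `k`-th power of an additive closure is the closure of the `k`-fold products; no scalars
arise, only repetitions, whence a multiset. -/
theorem AddSubmonoid.exists_multiset_of_mem_closure_range_pow {R ι : Type*} [CommSemiring R]
    {P : ι → R} {k : ℕ} {f : R} (hf : f ∈ AddSubmonoid.closure (Set.range P) ^ k) :
    ∃ s : Multiset (Fin k → ι), f = (s.map fun a => ∏ i, P (a i)).sum := by
  rw [AddSubmonoid.closure_pow] at hf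
  induction hf using AddSubmonoid.closure_induction with
  | mem x hx =>
    obtain ⟨y, rfl⟩ := Set.mem_pow.1 hx
    choose a ha using fun i => (y i).2
    exact ⟨{a}, by simp [List.prod_ofFn, ha]⟩
  | zero => exact ⟨0, by simp⟩
  | add x y _ _ hx hy =>
    obtain ⟨s, rfl⟩ := hx
    obtain ⟨s', rfl⟩ := hy
    exact ⟨s + s', by simp⟩

namespace ArithCircuit

variable {K : Type u} {σ : Type v}

/-- The index type of the low-degree polynomials from which `exists_family` builds all homogeneous
components of degree less than `n`. -/
abbrev FamilyIndex (C : ArithCircuit K σ) (n : ℕ) : Type :=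
  Bool ⊕ C.Part n ⊕ (C.Part n × C.Part n) ⊕ (C.Part n × (C.Part n × C.Part n))

theorem card_familyIndex_le (C : ArithCircuit K σ) (n : ℕ) :
    Fintype.card (C.FamilyIndex n) ≤ (C.size * n + 2) ^ 3 := by
  simp only [Fintype.card_sum, Fintype.card_prod, Fintype.card_fin, Fintype.card_bool]
  change 2 + (C.size * n + (C.size * n * (C.size * n) +
    C.size * n * (C.size * n * (C.size * n)))) ≤ _
  generalize C.size * n = a
  nlinarith [sq_nonneg a]

variable [CommSemiring K]

/-- If a family contains the low-degree components, their low-degree products of two and the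
coefficients of the frontier decompositions, then products of few of its members generate the
components of higher degree. -/
theorem comp_mem_pow (C : ArithCircuit K σ) {d t : ℕ} (ht : 1 ≤ t) {A : AddSubmonoid (MvPolynomial σ K)}
    (h1 : (1 : MvPolynomial σ K) ∈ A)
    (hcomp : ∀ g, ∀ i ≤ d, i ≤ t → C.comp g i ∈ A)
    (hmul : ∀ a b : C.Part (d + 1), (a.2 + b.2 : ℕ) ≤ t → C.part a * C.part b ∈ A)
    (hfrontier : ∀ g, ∀ i ≤ d, t < i → ∃ Q : C.Part (d + 1) × C.Part (d + 1) → MvPolynomial σ K,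
      (∀ w, Q w ∈ A) ∧
      (∀ w, Q w = 0 ∨ ((w.1.2 : ℕ) < i - t + 1 ∧ (w.2.2 : ℕ) < i - t + 1 ∧
        i - t + 1 ≤ (w.1.2 : ℕ) + w.2.2 ∧ (Q w).totalDegree + w.1.2 + w.2.2 ≤ i)) ∧
      C.comp g i = ∑ w, Q w * (C.part w.1 * C.part w.2))
    (i : ℕ) : i ≤ d → t < i → ∀ (g : C.Gate) (k : ℕ), 3 * i / t ≤ k + 1 → C.comp g i ∈ A ^ k := by
  induction i using Nat.strong_induction_on with
  | _ i ih =>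
  intro hid hti g k hk
  have hk' : 3 * i < (k + 2) * t := by
    rw [← Nat.div_lt_iff_lt_mul (by omega)]
    omega
  obtain ⟨Q, hQA, hQ, hsum⟩ := hfrontier g i hid hti
  rw [hsum]
  refine AddSubmonoid.sum_mem _ fun w _ => ?_
  rcases hQ w with h0 | ⟨hj, hl, hjl, hdeg⟩
  · rw [h0, zero_mul]
    exact zero_mem _
  obtain ⟨⟨a, j⟩, ⟨b, l⟩⟩ := w
  dsimp only at hj hl hjl hdeg ⊢
  have hQw := hQA ((a, j), (b, l))
  -- The coefficient costs one factor, the pair `y` more.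
  have key : ∀ x y : ℕ, x ≤ k → 1 + y ≤ x → C.comp a j * C.comp b l ∈ A ^ y →
      Q ((a, j), (b, l)) * (C.comp a j * C.comp b l) ∈ A ^ k := by
    intro x y hx hy hm
    refine AddSubmonoid.mem_pow_of_le h1 (le_trans hy hx) ?_
    rw [pow_add, pow_one]
    exact AddSubmonoid.mul_mem_mul hQw hm
  change Q ((a, j), (b, l)) * (C.comp a j * C.comp b l) ∈ A ^ k
  have hj' := Nat.div_mul_le_self (3 * (j : ℕ)) t
  have hl' := Nat.div_mul_le_self (3 * (l : ℕ)) t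
  have hi' : ∀ q, q * t ≤ 3 * i → q ≤ k + 1 := fun q hq =>
    le_trans ((Nat.le_div_iff_mul_le (by omega)).2 hq) hk
  have hbig : ∀ x : ℕ, t < x → 3 ≤ 3 * x / t := fun x hx =>
    (Nat.le_div_iff_mul_le (by omega)).2 (by omega)
  -- Here only two factors may be available (`i` barely above `t`), so the product of the pair must
  -- itself be a family member.
  by_cases hsmall : (j + l : ℕ) ≤ t
  · refine key 2 1 ?_ le_rfl ?_
    · have := hi' 3 (by omega)
      omega
    · rw [pow_one]
      exact hmul (a, j) (b, l) hsmall
  by_cases hjt : (j : ℕ) ≤ t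
  · by_cases hlt : (l : ℕ) ≤ t
    · refine key 3 2 ?_ le_rfl ?_
      -- If `k ≤ 2` then `3i < 4t`, but `t < j + l ≤ 2(i - t)` forces `2i > 3t`.
      · by_contra hcon
        have : (k + 2) * t ≤ 4 * t := Nat.mul_le_mul_right t (by omega)
        omega
      · rw [pow_two]
        exact AddSubmonoid.mul_mem_mul (hcomp a j (by omega) hjt) (hcomp b l (by omega) hlt)
    -- Since `l ≤ i - t`, the quotient `3 * l / t` is at least `3` below `3 * i / t`, which pays for
    -- the two extra factors.
    · have hb := hbig l (by omega)
      have := hi' (3 * l / t + 3) (by rw [add_mul]; omega)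
      refine key k (1 + (3 * l / t - 1)) le_rfl (by omega) ?_
      rw [pow_add, pow_one]
      exact AddSubmonoid.mul_mem_mul (hcomp a j (by omega) hjt)
        (ih l (by omega) (by omega) (by omega) b _ (by omega))
  · by_cases hlt : (l : ℕ) ≤ t
    · have hb := hbig j (by omega)
      have := hi' (3 * j / t + 3) (by rw [add_mul]; omega)
      refine key k ((3 * j / t - 1) + 1) le_rfl (by omega) ?_
      rw [pow_add, pow_one]
      exact AddSubmonoid.mul_mem_mul (ih j (by omega) (by omega) (by omega) a _ (by omega))
        (hcomp b l (by omega) hlt)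
    -- The two `-1`s combine with the `+1` for the coefficient into a single `-1`, and `j + l ≤ i`
    -- closes the recursion; `hbig` keeps the subtractions from truncating.
    · have hb := hbig j (by omega)
      have hb' := hbig l (by omega)
      have := hi' (3 * j / t + 3 * l / t) (by rw [add_mul]; omega)
      refine key k ((3 * j / t - 1) + (3 * l / t - 1)) le_rfl (by omega) ?_
      rw [pow_add]
      exact AddSubmonoid.mul_mem_mul (ih j (by omega) (by omega) (by omega) a _ (by omega))
        (ih l (by omega) (by omega) (by omega) b _ (by omega))

theorem exists_family (C : ArithCircuit K σ) (hC : C.IsBinary) {d t : ℕ} (ht : d ≤ t ∨ 1 ≤ t)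
    (hdt : 3 * d ≤ (t + 2) * t) :
    ∃ P : C.FamilyIndex (d + 1) → MvPolynomial σ K, (∀ a, (P a).totalDegree ≤ t) ∧
      P (Sum.inl false) = 0 ∧ ∀ g, ∀ i ≤ d, C.comp g i ∈ AddSubmonoid.closure (Set.range P) ^ (t + 1) := by
  classical
  have hex : ∀ a : C.Part (d + 1), ∃ Q : C.Part (d + 1) × C.Part (d + 1) → MvPolynomial σ K,
      1 ≤ t → t < a.2 →
      (∀ w, Q w = 0 ∨ ((w.1.2 : ℕ) < a.2 - t + 1 ∧ (w.2.2 : ℕ) < a.2 - t + 1 ∧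
        a.2 - t + 1 ≤ (w.1.2 : ℕ) + w.2.2 ∧ (Q w).totalDegree + w.1.2 + w.2.2 ≤ a.2)) ∧
      C.comp a.1 a.2 = ∑ w, Q w * (C.part w.1 * C.part w.2) := by
    intro a
    by_cases h : 1 ≤ t ∧ t < a.2
    · have ha := a.2.2
      -- This threshold is at least `2` exactly because the degree exceeds `t`.
      obtain ⟨Q, hQ⟩ := C.hasFrontier_comp hC (n := d + 1) (m := a.2 - t + 1) (by omega)
        (by omega) a.1 a.2 (by omega)
      exact ⟨Q, fun _ _ => hQ⟩
    · exact ⟨0, fun h1 h2 => absurd ⟨h1, h2⟩ h⟩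
  choose Q hQ using hex
  -- Makes the degree bound hold for every index; members of too high degree are never needed and
  -- become `0`.
  let cut : MvPolynomial σ K → MvPolynomial σ K := fun p => if p.totalDegree ≤ t then p else 0
  have hcut : ∀ p, (cut p).totalDegree ≤ t := fun p => by
    by_cases h : p.totalDegree ≤ t <;> simp [cut, h]
  have hcut' : ∀ p : MvPolynomial σ K, p.totalDegree ≤ t → cut p = p := fun p h => if_pos h
  let P : C.FamilyIndex (d + 1) → MvPolynomial σ K :=
    Sum.elim (fun b => if b then 1 else 0) (Sum.elim (fun a => cut (C.part a))
      (Sum.elim (fun w => cut (C.part w.1 * C.part w.2)) (fun w => cut (Q w.1 w.2))))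
  have hA : ∀ a, P a ∈ AddSubmonoid.closure (Set.range P) :=
    fun a => AddSubmonoid.subset_closure ⟨a, rfl⟩
  have h1 : (1 : MvPolynomial σ K) ∈ AddSubmonoid.closure (Set.range P) := hA (Sum.inl true)
  have hcomp : ∀ g, ∀ i ≤ d, i ≤ t → C.comp g i ∈ AddSubmonoid.closure (Set.range P) := by
    intro g i hi hit
    have := hA (Sum.inr (Sum.inl (g, ⟨i, by omega⟩)))
    change cut (C.comp g i) ∈ _ at this
    rwa [hcut' _ (le_trans (C.totalDegree_comp_le g i) hit)] at this
  refine ⟨P, ?_, rfl, fun g i hi => ?_⟩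
  · rintro (b | a | w | w)
    · cases b <;> simp [P]
    all_goals exact hcut _
  by_cases hit : i ≤ t
  · exact AddSubmonoid.mem_pow_of_le h1 (a := 1) (by omega) (by simpa using hcomp g i hi hit)
  have ht1 : 1 ≤ t := by omega
  refine C.comp_mem_pow (d := d) ht1 h1 hcomp (fun a b hab => ?_) (fun g i hi hti => ?_) i hi (by omega) g
    (t + 1) ?_
  · have := hA (Sum.inr (Sum.inr (Sum.inl (a, b))))
    change cut (C.part a * C.part b) ∈ _ at this
    rwa [hcut' _ ?_] at this
    have h := totalDegree_mul (C.part a) (C.part b)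
    have ha : (C.part a).totalDegree ≤ a.2 := C.totalDegree_comp_le _ _
    have hb : (C.part b).totalDegree ≤ b.2 := C.totalDegree_comp_le _ _
    omega
  · obtain ⟨hq, hs⟩ := hQ (g, ⟨i, by omega⟩) ht1 hti
    refine ⟨Q (g, ⟨i, by omega⟩), fun w => ?_, hq, hs⟩
    have := hA (Sum.inr (Sum.inr (Sum.inr ((g, ⟨i, by omega⟩), w))))
    change cut (Q (g, ⟨i, by omega⟩) w) ∈ _ at this
    rwa [hcut' _ ?_] at this
    rcases hq w with h0 | ⟨-, -, h3, h4⟩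
    · rw [h0, totalDegree_zero]
      exact Nat.zero_le t
    -- The pair has total degree at least `i - t + 1`, leaving at most `t - 1` for the coefficient.
    · dsimp only at h3 h4 ⊢
      omega
  · exact Nat.div_le_of_le_mul (by nlinarith)

end ArithCircuit

end Family

/-! ### Decomposition of `f` in its own variables, and monomials as words. -/

section Decomposition

open MvPolynomial
open scoped Pointwise

namespace MvPolynomial

variable {K : Type u} {σ : Type v} [CommSemiring K]

open Classical in
/-- Substitution of `0` for the variables outside `V`. -/
noncomputable def restrictVars (V : Finset σ) : MvPolynomial σ K →ₐ[K] MvPolynomial σ K :=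
  aeval fun x => if x ∈ V then X x else 0

theorem restrictVars_eq_self {V : Finset σ} {p : MvPolynomial σ K} (h : p.vars ⊆ V) :
    restrictVars V p = p := by
  have := hom_congr_vars (f₁ := (restrictVars V : MvPolynomial σ K →ₐ[K] _).toRingHom)
    (f₂ := RingHom.id _) (p₁ := p) (p₂ := p) ?_ ?_ rfl
  · exact this
  · ext1 a
    simp
  · intro i hi _
    simp [restrictVars, h hi]

theorem vars_restrictVars_subset (V : Finset σ) (p : MvPolynomial σ K) :
    (restrictVars V p).vars ⊆ V := by
  have : restrictVars V p ∈ supported K (V : Set σ) := by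
    induction p using MvPolynomial.induction_on with
    | C a =>
      rw [← algebraMap_eq, AlgHom.commutes]
      exact Subalgebra.algebraMap_mem _ a
    | add p q hp hq =>
      rw [map_add]
      exact add_mem hp hq
    | mul_X p x hp =>
      rw [map_mul]
      refine mul_mem hp ?_
      by_cases hx : x ∈ V
      · rw [restrictVars, aeval_X, if_pos hx]
        exact Algebra.subset_adjoin (Set.mem_image_of_mem X hx)
      · simp [restrictVars, hx]
  exact_mod_cast mem_supported.1 this

theorem totalDegree_restrictVars_le (V : Finset σ) (p : MvPolynomial σ K) :
    (restrictVars V p).totalDegree ≤ p.totalDegree := by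
  classical
  conv_lhs => rw [p.as_sum, map_sum]
  refine totalDegree_finsetSum_le fun m hm => ?_
  refine le_trans ?_ (le_totalDegree hm)
  rw [restrictVars, aeval_monomial, Finsupp.prod]
  refine le_trans (totalDegree_mul _ _) ?_
  rw [algebraMap_eq, totalDegree_C, zero_add]
  refine le_trans (totalDegree_finsetProd _ _) (Finset.sum_le_sum fun x _ => ?_)
  refine le_trans (totalDegree_pow _ _) ?_
  split_ifs with hx
  · exact le_trans (Nat.mul_le_mul_left _ (isHomogeneous_X K x).totalDegree_le) (by simp)
  · simp

end MvPolynomial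

namespace ArithCircuit

variable {K : Type u} {σ : Type v} [CommSemiring K]

/-- The circuit may use variables that cancel in `f`; setting them to `0` fixes `f` and raises no
degree. -/
theorem exists_decomposition (C : ArithCircuit K σ) (hC : C.IsBinary) {f : MvPolynomial σ K}
    (hf : C.Computes f) {t : ℕ} (ht : f.totalDegree ≤ t ∨ 1 ≤ t)
    (hdt : 3 * f.totalDegree ≤ (t + 2) * t) :
    ∃ P : C.FamilyIndex (f.totalDegree + 1) → MvPolynomial σ K,
      (∀ a, (P a).totalDegree ≤ t) ∧ (∀ a, (P a).vars ⊆ f.vars) ∧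
      ∃ s : Multiset (Fin (t + 1) → C.FamilyIndex (f.totalDegree + 1)), s ≠ 0 ∧
        f = (s.map fun a => ∏ i, P (a i)).sum := by
  obtain ⟨P, hdeg, hzero, hP⟩ := C.exists_family hC ht hdt
  have hmem : f ∈ AddSubmonoid.closure (Set.range P) ^ (t + 1) := by
    have hsum := sum_homogeneousComponent f
    refine Eq.subst (motive := fun q => q ∈ AddSubmonoid.closure (Set.range P) ^ (t + 1)) hsum ?_
    refine AddSubmonoid.sum_mem _ fun i hi => ?_
    rw [Finset.mem_range] at hi
    have := hP C.out i (by omega)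
    rwa [comp, show C.eval C.out = f from hf] at this
  obtain ⟨s, hs⟩ := AddSubmonoid.exists_multiset_of_mem_closure_range_pow hmem
  refine ⟨fun a => restrictVars f.vars (P a),
    fun a => le_trans (totalDegree_restrictVars_le _ _) (hdeg a),
    -- The added product consists of zeros; it keeps the output gate from being empty.
    fun a => vars_restrictVars_subset _ _, (fun _ => Sum.inl false) ::ₘ s,
    Multiset.cons_ne_zero, ?_⟩
  have h0 := restrictVars_eq_self (Finset.Subset.refl f.vars)
  have h1 := congrArg (restrictVars f.vars) hs
  rw [h0, map_multiset_sum, Multiset.map_map] at h1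
  simpa [hzero, map_prod] using h1

/-- Every variable of `f` sits at some input gate, and distinct variables at distinct gates. -/
theorem card_vars_le_size (C : ArithCircuit K σ) {f : MvPolynomial σ K} (hf : C.Computes f) :
    f.vars.card ≤ C.size := by
  classical
  have key : ∀ g, C.eval g ∈ supported K {x | ∃ g, C.op g = GateOp.var x} := by
    intro g
    induction g using C.acyclic.induction with
    | _ g ih =>
    rw [C.eval_eq]
    cases hop : C.op g with
    | var x => exact Algebra.subset_adjoin (Set.mem_image_of_mem X ⟨g, hop⟩)
    | const c => exact Subalgebra.algebraMap_mem _ c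
    | add s =>
      refine multiset_sum_mem _ fun p hp => ?_
      obtain ⟨a, ha, rfl⟩ := Multiset.mem_map.1 hp
      exact ih a (by rw [hop]; exact ha)
    | mul s =>
      refine multiset_prod_mem _ fun p hp => ?_
      obtain ⟨a, ha, rfl⟩ := Multiset.mem_map.1 hp
      exact ih a (by rw [hop]; exact ha)
  have hout := mem_supported.1 (key C.out)
  rw [show C.eval C.out = f from hf] at hout
  choose e he using fun x : f.vars => hout x.2
  have := Fintype.card_le_of_injective e fun x y hxy => by
    have h := he x
    rw [hxy, he y] at h
    exact Subtype.ext (GateOp.var.inj h).symm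
  simpa [size] using this

end ArithCircuit

namespace MvPolynomial

variable {K : Type u} {σ : Type v} [CommSemiring K]

/-- The polynomial carried by an input gate with the given label. -/
noncomputable def leafPoly : K ⊕ σ → MvPolynomial σ K := Sum.elim C X

/-- The label of a letter: a variable of `V`, or the constant `1` for padding. -/
noncomputable def letterLabel (K : Type u) [CommSemiring K] (V : Finset σ) :
    Option (Fin V.card) → K ⊕ σ
  | none => Sum.inl 1
  | some j => Sum.inr (V.equivFin.symm j)

theorem exists_word_of_multiset (V : Finset σ) (t : ℕ) :
    ∀ s : Multiset σ, Multiset.card s ≤ t → (∀ x ∈ s, x ∈ V) →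
      ∃ w : Fin t → Option (Fin V.card),
        ∏ i, leafPoly (letterLabel K V (w i)) = (s.map X).prod := by
  induction t with
  | zero =>
    intro s hs _
    have : s = 0 := by simpa using hs
    exact ⟨Fin.elim0, by simp [this]⟩
  | succ t ih =>
    intro s
    induction s using Multiset.induction with
    | empty => exact fun _ _ => ⟨fun _ => none, by simp [letterLabel, leafPoly]⟩
    | cons a s _ =>
      intro hs hV
      obtain ⟨w, hw⟩ := ih s (by simpa using hs) fun x hx => hV x (by simp [hx])
      refine ⟨Fin.cons (some (V.equivFin ⟨a, hV a (by simp)⟩)) w, ?_⟩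
      rw [Fin.prod_univ_succ]
      simp only [Fin.cons_zero, Fin.cons_succ, hw]
      simp [letterLabel, leafPoly]

/-- Padding monomials with `1` to length exactly `t` gives a uniform shape, with at most `(|V| + 1)
^ t` terms. A monomial has many spellings; one of them carries its coefficient. -/
theorem exists_sum_words {V : Finset σ} {t : ℕ} {p : MvPolynomial σ K} (hdeg : p.totalDegree ≤ t)
    (hV : p.vars ⊆ V) :
    ∃ c : (Fin t → Option (Fin V.card)) → K,
      p = ∑ w, C (c w) * ∏ i, leafPoly (letterLabel K V (w i)) := by
  classical
  rw [p.as_sum]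
  refine Finset.sum_induction _ (fun q : MvPolynomial σ K =>
    ∃ c : (Fin t → Option (Fin V.card)) → K,
      q = ∑ w, C (c w) * ∏ i, leafPoly (letterLabel K V (w i))) ?_ ⟨0, by simp⟩ ?_
  · rintro _ _ ⟨c, rfl⟩ ⟨c', rfl⟩
    exact ⟨c + c', by simp [add_mul, Finset.sum_add_distrib]⟩
  · intro m hm
    obtain ⟨w, hw⟩ := exists_word_of_multiset (K := K) V t (Finsupp.toMultiset m)
      (by
        rw [Finsupp.card_toMultiset]
        exact le_trans (le_totalDegree hm) hdeg)
      (fun x hx => hV (mem_vars_iff_mem_support x |>.2 ⟨m, hm, by simpa using hx⟩))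
    refine ⟨fun w' => if w' = w then coeff m p else 0, ?_⟩
    rw [Finset.sum_eq_single w (fun w' _ h => by simp [h]) (by simp), hw]
    dsimp only
    rw [if_pos rfl,
      Finsupp.toMultiset_map, Finsupp.prod_toMultiset, monomial_eq,
      Finsupp.prod_mapDomain_index (by simp) (by simp [pow_add])]

end MvPolynomial

end Decomposition

/-! ### Layered `ΣΠΣΠ` circuits: value, levels, gate counts, fan-out. -/

section Layered

open MvPolynomial

/-- The gates of a circuit with levels `0` to `4` and a single gate at level `4`. -/
inductive LayeredGate (A₃ A₂ A₁ A₀ : Type) : Type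
  | top
  | lvl3 (a : A₃)
  | lvl2 (a : A₂)
  | lvl1 (a : A₁)
  | lvl0 (a : A₀)

namespace LayeredGate

variable {A₃ A₂ A₁ A₀ : Type}

/-- The gates as a disjoint union of the levels. -/
def equivSum : Unit ⊕ A₃ ⊕ A₂ ⊕ A₁ ⊕ A₀ ≃ LayeredGate A₃ A₂ A₁ A₀ where
  toFun
    | .inl _ => top
    | .inr (.inl a) => lvl3 a
    | .inr (.inr (.inl a)) => lvl2 a
    | .inr (.inr (.inr (.inl a))) => lvl1 a
    | .inr (.inr (.inr (.inr a))) => lvl0 a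
  invFun
    | top => .inl ()
    | lvl3 a => .inr (.inl a)
    | lvl2 a => .inr (.inr (.inl a))
    | lvl1 a => .inr (.inr (.inr (.inl a)))
    | lvl0 a => .inr (.inr (.inr (.inr a)))
  left_inv := by rintro (_ | _ | _ | _ | _) <;> rfl
  right_inv := by rintro (_ | _ | _ | _ | _) <;> rfl

instance [Fintype A₃] [Fintype A₂] [Fintype A₁] [Fintype A₀] :
    Fintype (LayeredGate A₃ A₂ A₁ A₀) :=
  Fintype.ofEquiv _ equivSum

/-- The level of a gate. -/
def level : LayeredGate A₃ A₂ A₁ A₀ → ℕ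
  | top => 4
  | lvl3 _ => 3
  | lvl2 _ => 2
  | lvl1 _ => 1
  | lvl0 _ => 0

theorem sum_univ [Fintype A₃] [Fintype A₂] [Fintype A₁] [Fintype A₀]
    (f : LayeredGate A₃ A₂ A₁ A₀ → ℕ) :
    ∑ g, f g = f top + ((∑ a, f (lvl3 a)) + ((∑ a, f (lvl2 a)) +
      ((∑ a, f (lvl1 a)) + ∑ a, f (lvl0 a)))) := by
  rw [← equivSum.sum_comp]
  simp [Fintype.sum_sum_type, equivSum]

end LayeredGate

namespace ArithCircuit

open LayeredGate

variable {K : Type u} {σ : Type v} {A₃ A₂ A₁ A₀ : Type}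
  [Fintype A₃] [Fintype A₂] [Fintype A₁] [Fintype A₀]

/-- The operations of the gates of `layered`. -/
def layeredOp (c₄ : Multiset A₃) (c₃ : A₃ → Multiset A₂) (c₂ : A₂ → Multiset A₁)
    (c₁ : A₁ → Multiset A₀) (leaf : A₀ → K ⊕ σ) :
    LayeredGate A₃ A₂ A₁ A₀ → GateOp K σ (LayeredGate A₃ A₂ A₁ A₀)
  | top => .add (c₄.map lvl3)
  | lvl3 a => .mul ((c₃ a).map lvl2)
  | lvl2 a => .add ((c₂ a).map lvl1)
  | lvl1 a => .mul ((c₁ a).map lvl0)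
  | lvl0 a => Sum.elim .const .var (leaf a)

/-- The depth-four circuit with the given wires between consecutive levels. -/
def layered (c₄ : Multiset A₃) (c₃ : A₃ → Multiset A₂) (c₂ : A₂ → Multiset A₁)
    (c₁ : A₁ → Multiset A₀) (leaf : A₀ → K ⊕ σ) : ArithCircuit K σ where
  Gate := LayeredGate A₃ A₂ A₁ A₀
  op := layeredOp c₄ c₃ c₂ c₁ leaf
  acyclic := by
    refine Subrelation.wf (r := InvImage (· < ·) level) ?_ (InvImage.wf _ wellFounded_lt)
    intro a b h
    rcases b with _ | b | b | b | b
    · obtain ⟨x, -, rfl⟩ := Multiset.mem_map.1 h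
      exact Nat.lt_succ_self 3
    · obtain ⟨x, -, rfl⟩ := Multiset.mem_map.1 h
      exact Nat.lt_succ_self 2
    · obtain ⟨x, -, rfl⟩ := Multiset.mem_map.1 h
      exact Nat.lt_succ_self 1
    · obtain ⟨x, -, rfl⟩ := Multiset.mem_map.1 h
      exact Nat.lt_succ_self 0
    · change a ∈ (Sum.elim GateOp.const GateOp.var (leaf b)).children at h
      cases hl : leaf b <;> rw [hl] at h <;> exact absurd h (Multiset.notMem_zero _)
  out := top

variable (c₄ : Multiset A₃) (c₃ : A₃ → Multiset A₂) (c₂ : A₂ → Multiset A₁)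
  (c₁ : A₁ → Multiset A₀) (leaf : A₀ → K ⊕ σ)

theorem eval_layered_out [CommSemiring K] :
    (layered c₄ c₃ c₂ c₁ leaf).eval (layered c₄ c₃ c₂ c₁ leaf).out =
      (c₄.map fun a => ((c₃ a).map fun b => ((c₂ b).map fun c =>
        ((c₁ c).map fun x => leafPoly (leaf x)).prod).sum).prod).sum := by
  -- Only the local gate equations matter, so the evaluation is replaced by any function satisfying
  -- them.
  suffices H : ∀ ev : LayeredGate A₃ A₂ A₁ A₀ → MvPolynomial σ K,
      (∀ g x, layeredOp c₄ c₃ c₂ c₁ leaf g = .var x → ev g = X x) →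
      (∀ g c, layeredOp c₄ c₃ c₂ c₁ leaf g = .const c → ev g = C c) →
      (∀ g s, layeredOp c₄ c₃ c₂ c₁ leaf g = .add s → ev g = (s.map ev).sum) →
      (∀ g s, layeredOp c₄ c₃ c₂ c₁ leaf g = .mul s → ev g = (s.map ev).prod) →
      ev top = (c₄.map fun a => ((c₃ a).map fun b => ((c₂ b).map fun c =>
        ((c₁ c).map fun x => leafPoly (leaf x)).prod).sum).prod).sum by
    have heval := (layered c₄ c₃ c₂ c₁ leaf).eval_eq
    refine H (layered c₄ c₃ c₂ c₁ leaf).eval (fun g x h => ?_) (fun g x h => ?_)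
      (fun g x h => ?_) (fun g x h => ?_) <;>
    · have hg := heval g
      change (layered c₄ c₃ c₂ c₁ leaf).op g = _ at h
      rw [h] at hg
      exact hg
  intro ev hvar hconst hadd hmul
  have h0 : ∀ x, ev (lvl0 x) = leafPoly (leaf x) := by
    intro x
    cases hl : leaf x with
    | inl c => exact hconst _ c (by simp [layeredOp, hl])
    | inr y => exact hvar _ y (by simp [layeredOp, hl])
  have h1 : ∀ x, ev (lvl1 x) = ((c₁ x).map fun x => leafPoly (leaf x)).prod := by
    intro x
    rw [hmul _ _ rfl]
    simp only [Multiset.map_map, Function.comp_def, h0]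
  have h2 : ∀ x, ev (lvl2 x) = ((c₂ x).map fun x => ev (lvl1 x)).sum := by
    intro x
    rw [hadd _ _ rfl]
    simp only [Multiset.map_map, Function.comp_def]
  have h3 : ∀ x, ev (lvl3 x) = ((c₃ x).map fun x => ev (lvl2 x)).prod := by
    intro x
    rw [hmul _ _ rfl]
    simp only [Multiset.map_map, Function.comp_def]
  rw [hadd _ _ rfl]
  simp only [Multiset.map_map, Function.comp_def, h3, h2, h1]

theorem isDepthFour_layered (h₄ : c₄ ≠ 0) (h₃ : ∀ a, c₃ a ≠ 0) (h₂ : ∀ a, c₂ a ≠ 0)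
    (h₁ : ∀ a, c₁ a ≠ 0) : (layered c₄ c₃ c₂ c₁ leaf).IsDepthFour := by
  refine ⟨level, rfl, ?_, ?_, ?_, ?_, ?_⟩
  · rintro (_ | a | a | a | a) h
    · exact h.elim
    · exact h.elim
    · exact h.elim
    · exact h.elim
    · rfl
  · rintro (_ | a | a | a | a) h
    · exact Or.inr rfl
    · exact h.elim
    · exact Or.inl rfl
    · exact h.elim
    · change (Sum.elim GateOp.const GateOp.var (leaf a)).IsAdd at h
      cases hl : leaf a <;> rw [hl] at h <;> exact h.elim
  · rintro (_ | a | a | a | a) h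
    · exact h.elim
    · exact Or.inr rfl
    · exact h.elim
    · exact Or.inl rfl
    · change (Sum.elim GateOp.const GateOp.var (leaf a)).IsMul at h
      cases hl : leaf a <;> rw [hl] at h <;> exact h.elim
  · rintro (_ | a | a | a | a) h h'
    · exact h₄ (Multiset.map_eq_zero.1 h')
    · exact h₃ a (Multiset.map_eq_zero.1 h')
    · exact h₂ a (Multiset.map_eq_zero.1 h')
    · exact h₁ a (Multiset.map_eq_zero.1 h')
    · refine h ?_
      change (Sum.elim GateOp.const GateOp.var (leaf a)).IsInput
      cases leaf a <;> trivial
  · rintro (_ | a | a | a | a) b h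
    · obtain ⟨x, -, rfl⟩ := Multiset.mem_map.1 h
      rfl
    · obtain ⟨x, -, rfl⟩ := Multiset.mem_map.1 h
      rfl
    · obtain ⟨x, -, rfl⟩ := Multiset.mem_map.1 h
      rfl
    · obtain ⟨x, -, rfl⟩ := Multiset.mem_map.1 h
      rfl
    · change b ∈ (Sum.elim GateOp.const GateOp.var (leaf a)).children at h
      cases hl : leaf a <;> rw [hl] at h <;> exact absurd h (Multiset.notMem_zero _)

theorem varsIn_layered {S : Set σ} (h : ∀ a x, leaf a = Sum.inr x → x ∈ S) :
    (layered c₄ c₃ c₂ c₁ leaf).VarsIn S := by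
  rintro (_ | a | a | a | a) x hx
  · cases hx
  · cases hx
  · cases hx
  · cases hx
  · change Sum.elim GateOp.const GateOp.var (leaf a) = _ at hx
    cases hl : leaf a with
    | inl c => rw [hl] at hx; cases hx
    | inr y =>
      rw [hl] at hx
      cases hx
      exact h a x hl

theorem mulFanInLE_layered {B : ℝ} (h₃ : ∀ a, (Multiset.card (c₃ a) : ℝ) ≤ B)
    (h₁ : ∀ a, (Multiset.card (c₁ a) : ℝ) ≤ B) :
    (layered c₄ c₃ c₂ c₁ leaf).MulFanInLE B := by
  rintro (_ | a | a | a | a) h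
  · exact h.elim
  · change (Multiset.card ((c₃ a).map lvl2) : ℝ) ≤ B
    rw [Multiset.card_map]
    exact h₃ a
  · exact h.elim
  · change (Multiset.card ((c₁ a).map lvl0) : ℝ) ≤ B
    rw [Multiset.card_map]
    exact h₁ a
  · change (Sum.elim GateOp.const GateOp.var (leaf a)).IsMul at h
    cases hl : leaf a <;> rw [hl] at h <;> exact h.elim

theorem size_layered : (layered c₄ c₃ c₂ c₁ leaf).size =
    1 + (Fintype.card A₃ + (Fintype.card A₂ + (Fintype.card A₁ + Fintype.card A₀))) := by
  change Fintype.card (LayeredGate A₃ A₂ A₁ A₀) = _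
  rw [← Fintype.card_congr equivSum]
  simp only [Fintype.card_sum, Fintype.card_unit]

theorem numAdd_layered_le : (layered c₄ c₃ c₂ c₁ leaf).numAdd ≤ 1 + Fintype.card A₂ := by
  change {g | (layeredOp c₄ c₃ c₂ c₁ leaf g).IsAdd}.ncard ≤ _
  have hsub : {g | (layeredOp c₄ c₃ c₂ c₁ leaf g).IsAdd} ⊆
      Set.range (Sum.elim (fun _ : Unit => top) lvl2 : Unit ⊕ A₂ → LayeredGate A₃ A₂ A₁ A₀) := by
    rintro (_ | a | a | a | a) h
    · exact ⟨Sum.inl (), rfl⟩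
    · exact h.elim
    · exact ⟨Sum.inr a, rfl⟩
    · exact h.elim
    · change (Sum.elim GateOp.const GateOp.var (leaf a)).IsAdd at h
      cases hl : leaf a <;> rw [hl] at h <;> exact h.elim
  refine le_trans (Set.ncard_le_ncard hsub (Set.finite_range _)) ?_
  rw [← Set.image_univ]
  refine le_trans (Set.ncard_image_le Set.finite_univ) ?_
  rw [Set.ncard_univ, Nat.card_eq_fintype_card, Fintype.card_sum, Fintype.card_unit]

theorem numMul_layered_le :
    (layered c₄ c₃ c₂ c₁ leaf).numMul ≤ Fintype.card A₃ + Fintype.card A₁ := by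
  change {g | (layeredOp c₄ c₃ c₂ c₁ leaf g).IsMul}.ncard ≤ _
  have hsub : {g | (layeredOp c₄ c₃ c₂ c₁ leaf g).IsMul} ⊆
      Set.range (Sum.elim lvl3 lvl1 : A₃ ⊕ A₁ → LayeredGate A₃ A₂ A₁ A₀) := by
    rintro (_ | a | a | a | a) h
    · exact h.elim
    · exact ⟨Sum.inl a, rfl⟩
    · exact h.elim
    · exact ⟨Sum.inr a, rfl⟩
    · change (Sum.elim GateOp.const GateOp.var (leaf a)).IsMul at h
      cases hl : leaf a <;> rw [hl] at h <;> exact h.elim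
  refine le_trans (Set.ncard_le_ncard hsub (Set.finite_range _)) ?_
  rw [← Set.image_univ]
  refine le_trans (Set.ncard_image_le Set.finite_univ) ?_
  rw [Set.ncard_univ, Nat.card_eq_fintype_card, Fintype.card_sum]

open Classical in
theorem fanOut_layered (g : LayeredGate A₃ A₂ A₁ A₀) :
    (layered c₄ c₃ c₂ c₁ leaf).fanOut g = (c₄.map lvl3).count g +
      ((∑ a, ((c₃ a).map lvl2).count g) + ((∑ a, ((c₂ a).map lvl1).count g) +
        ∑ a, ((c₁ a).map lvl0).count g)) := by
  change ∑ b : LayeredGate A₃ A₂ A₁ A₀, (layeredOp c₄ c₃ c₂ c₁ leaf b).children.count g = _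
  have h0 : ∀ a, (layeredOp c₄ c₃ c₂ c₁ leaf (lvl0 a)).children = 0 := by
    intro a
    rw [layeredOp]
    cases leaf a <;> rfl
  rw [LayeredGate.sum_univ]
  simp only [h0, Multiset.count_zero, Finset.sum_const_zero, add_zero]
  rfl

open Classical in
theorem fanOut_layered_lvl0 (x : A₀) :
    (layered c₄ c₃ c₂ c₁ leaf).fanOut (lvl0 x : LayeredGate A₃ A₂ A₁ A₀) =
      ∑ a, (c₁ a).count x := by
  rw [fanOut_layered]
  have : Function.Injective (lvl0 : A₀ → LayeredGate A₃ A₂ A₁ A₀) := fun _ _ h => by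
    injection h
  simp [Multiset.count_eq_zero_of_notMem, Multiset.count_map_eq_count' _ _ this]

open Classical in
theorem fanOut_layered_lvl1 (x : A₁) :
    (layered c₄ c₃ c₂ c₁ leaf).fanOut (lvl1 x : LayeredGate A₃ A₂ A₁ A₀) =
      ∑ a, (c₂ a).count x := by
  rw [fanOut_layered]
  have : Function.Injective (lvl1 : A₁ → LayeredGate A₃ A₂ A₁ A₀) := fun _ _ h => by
    injection h
  simp [Multiset.count_eq_zero_of_notMem, Multiset.count_map_eq_count' _ _ this]

open Classical in
theorem fanOut_layered_lvl2 (x : A₂) :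
    (layered c₄ c₃ c₂ c₁ leaf).fanOut (lvl2 x : LayeredGate A₃ A₂ A₁ A₀) =
      ∑ a, (c₃ a).count x := by
  rw [fanOut_layered]
  have : Function.Injective (lvl2 : A₂ → LayeredGate A₃ A₂ A₁ A₀) := fun _ _ h => by
    injection h
  simp [Multiset.count_eq_zero_of_notMem, Multiset.count_map_eq_count' _ _ this]

open Classical in
theorem fanOut_layered_lvl3 (x : A₃) :
    (layered c₄ c₃ c₂ c₁ leaf).fanOut (lvl3 x : LayeredGate A₃ A₂ A₁ A₀) = c₄.count x := by
  rw [fanOut_layered]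
  have : Function.Injective (lvl3 : A₃ → LayeredGate A₃ A₂ A₁ A₀) := fun _ _ h => by
    injection h
  simp [Multiset.count_eq_zero_of_notMem, Multiset.count_map_eq_count' _ _ this]

theorem fanOut_layered_top :
    (layered c₄ c₃ c₂ c₁ leaf).fanOut (top : LayeredGate A₃ A₂ A₁ A₀) = 0 := by
  rw [fanOut_layered]
  simp [Multiset.count_eq_zero_of_notMem]

/-- The wires from `a` to all pairs with first component `a`. -/
def fibre {A : Type} (B : Type) [Fintype B] (a : A) : Multiset (A × B) :=
  Finset.univ.val.map (Prod.mk a)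

theorem card_fibre {A : Type} (B : Type) [Fintype B] (a : A) :
    Multiset.card (fibre B a) = Fintype.card B := by
  simp [fibre]

theorem fibre_ne_zero {A : Type} (B : Type) [Fintype B] [Nonempty B] (a : A) :
    fibre B a ≠ 0 := by
  rw [← Multiset.card_pos, card_fibre]
  exact Fintype.card_pos

/-- A pair is wired only to its first component: this gives fan-out one wherever a layer is wired by
`fibre`. -/
theorem sum_count_fibre {A B : Type} [Fintype A] [Fintype B] {_ : DecidableEq (A × B)} (x : A × B) :
    ∑ a, (fibre B a).count x = 1 := by
  classical
  rw [Finset.sum_eq_single x.1]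
  · obtain ⟨a, b⟩ := x
    have : Function.Injective (Prod.mk a : B → A × B) := fun _ _ h => by injection h
    rw [fibre, Multiset.count_map_eq_count' _ _ this]
    exact Multiset.count_eq_one_of_mem Finset.univ.nodup (Finset.mem_univ b)
  · intro a _ ha
    refine Multiset.count_eq_zero_of_notMem fun h => ha ?_
    obtain ⟨b, -, rfl⟩ := Multiset.mem_map.1 h
    rfl
  · simp

end ArithCircuit

end Layered

/-! ### Circuits and formulas from a decomposition. -/

section FromDecomposition

open MvPolynomial

namespace ArithCircuit

variable {K : Type u} {σ : Type v} [CommSemiring K]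

/-- The labels of the inputs of the gate computing `c` times the monomial spelled by `w`. -/
noncomputable def termLabel (V : Finset σ) {t : ℕ} (c : K) (w : Fin t → Option (Fin V.card)) :
    Fin (t + 1) → K ⊕ σ :=
  Fin.cons (Sum.inl c) fun i => letterLabel K V (w i)

theorem prod_leafPoly_termLabel (V : Finset σ) {t : ℕ} (c : K)
    (w : Fin t → Option (Fin V.card)) :
    ∏ i, leafPoly (termLabel V c w i) = C c * ∏ i, leafPoly (letterLabel K V (w i)) := by
  rw [Fin.prod_univ_succ]
  rfl

theorem mem_of_termLabel_eq {V : Finset σ} {t : ℕ} {c : K} {w : Fin t → Option (Fin V.card)}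
    {i : Fin (t + 1)} {x : σ} (h : termLabel V c w i = Sum.inr x) : x ∈ V := by
  induction i using Fin.cases with
  | zero => cases h
  | succ i =>
    change letterLabel K V (w i) = Sum.inr x at h
    cases hw : w i with
    | none => rw [hw] at h; cases h
    | some j =>
      rw [hw] at h
      cases h
      exact (V.equivFin.symm j).2

/-- One addition gate per family member is shared by all upper products. Only the layers below it
are trees, and repeated products become repeated wires. The coefficient is the extra input making
the lower fan-in `t + 1`. -/
theorem exists_circuit_of_decomposition {f : MvPolynomial σ K} {ι : Type} [Fintype ι] {t : ℕ}
    (P : ι → MvPolynomial σ K) (hdeg : ∀ a, (P a).totalDegree ≤ t)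
    (hvars : ∀ a, (P a).vars ⊆ f.vars) (s : Multiset (Fin (t + 1) → ι)) (hs : s ≠ 0)
    (hf : f = (s.map fun a => ∏ i, P (a i)).sum) {B : ℝ} (hB : (t : ℝ) + 1 ≤ B) :
    ∃ Γ : ArithCircuit K σ, Γ.Computes f ∧ Γ.IsDepthFour ∧ Γ.InputsUnshared ∧
      Γ.VarsIn {x | x ∈ f.vars} ∧ Γ.MulFanInLE B ∧
      Γ.numAdd ≤ 1 + Fintype.card ι ∧
      Γ.numMul ≤ Fintype.card ι ^ (t + 1) + Fintype.card ι * (f.vars.card + 1) ^ t := by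
  classical
  choose c hc using fun a => exists_sum_words (hdeg a) (hvars a)
  let W : Type := Fin t → Option (Fin f.vars.card)
  let c₃ : (Fin (t + 1) → ι) → Multiset ι := fun a => Finset.univ.val.map a
  let c₂ : ι → Multiset (ι × W) := fibre W
  let c₁ : ι × W → Multiset ((ι × W) × Fin (t + 1)) := fibre (Fin (t + 1))
  let leaf : (ι × W) × Fin (t + 1) → K ⊕ σ := fun q => termLabel f.vars (c q.1.1 q.1.2) q.1.2 q.2
  have hcard : (Multiset.card (Finset.univ : Finset (Fin (t + 1))).val : ℝ) ≤ B := by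
    simpa using hB
  have hfib : ∀ {A' : Type} (a : A'), (Multiset.card (fibre (Fin (t + 1)) a) : ℝ) ≤ B := by
    intro A' a
    simpa [card_fibre] using hB
  refine ⟨layered s c₃ c₂ c₁ leaf, ?_, ?_, ?_, ?_, ?_, numAdd_layered_le _ _ _ _ _, ?_⟩
  · refine (eval_layered_out _ _ _ _ _).trans ?_
    conv_rhs => rw [hf]
    congr 1
    refine Multiset.map_congr rfl fun a _ => ?_
    simp only [c₃, c₂, c₁, leaf, fibre, Multiset.map_map, Function.comp_def]
    change ∏ i, ∑ w, ∏ j, leafPoly (termLabel f.vars (c (a i) w) w j) = _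
    simp only [prod_leafPoly_termLabel, ← hc]
  · refine isDepthFour_layered _ _ _ _ _ hs (fun a => ?_) (fibre_ne_zero W)
      (fibre_ne_zero (Fin (t + 1)))
    rw [← Multiset.card_pos]
    simp [c₃]
  · rintro (_ | a | a | a | a) h
    · exact h.elim
    · exact h.elim
    · exact h.elim
    · exact h.elim
    · exact ((fanOut_layered_lvl0 _ _ _ _ _ a).trans (sum_count_fibre a)).le
  · exact varsIn_layered _ _ _ _ _ fun q x h => mem_of_termLabel_eq h
  · refine mulFanInLE_layered _ _ _ _ _ (fun a => ?_) fun a => ?_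
    · rw [Multiset.card_map]
      exact hcard
    · exact hfib a
  · refine (numMul_layered_le _ _ _ _ _).trans ?_
    simp [W]

/-- Every possible product gets one gate with private copies of its factors. Multiplicities,
including zero, cannot be repeated wires here, so they go into the coefficients. -/
theorem exists_formula_of_decomposition {f : MvPolynomial σ K} {ι : Type} [Fintype ι] [Nonempty ι]
    {t : ℕ}
    (P : ι → MvPolynomial σ K) (hdeg : ∀ a, (P a).totalDegree ≤ t)
    (hvars : ∀ a, (P a).vars ⊆ f.vars) (s : Multiset (Fin (t + 1) → ι))
    (hf : f = (s.map fun a => ∏ i, P (a i)).sum) {B : ℝ} (hB : (t : ℝ) + 1 ≤ B) :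
    ∃ F : ArithCircuit K σ, F.Computes f ∧ F.IsDepthFour ∧ F.IsFormula ∧
      F.VarsIn {x | x ∈ f.vars} ∧ F.MulFanInLE B ∧
      F.size = 1 + (Fintype.card ι ^ (t + 1) + (Fintype.card ι ^ (t + 1) * (t + 1) +
        (Fintype.card ι ^ (t + 1) * (t + 1) * (f.vars.card + 1) ^ t +
          Fintype.card ι ^ (t + 1) * (t + 1) * (f.vars.card + 1) ^ t * (t + 1)))) := by
  classical
  let A : Type := Fin (t + 1) → ι
  let R : A → Fin (t + 1) → MvPolynomial σ K :=
    -- The first factor alone carries the multiplicity, so that it enters the product once.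
    fun a i => C (if i = 0 then (s.count a : K) else 1) * P (a i)
  have hR : ∀ q : A × Fin (t + 1), ∃ c : (Fin t → Option (Fin f.vars.card)) → K,
      R q.1 q.2 = ∑ w, C (c w) * ∏ i, leafPoly (letterLabel K f.vars (w i)) := by
    intro q
    obtain ⟨c, hc⟩ := exists_sum_words (hdeg (q.1 q.2)) (hvars (q.1 q.2))
    refine ⟨fun w => (if q.2 = 0 then (s.count q.1 : K) else 1) * c w, ?_⟩
    simp only [R]
    conv_lhs => rw [hc, Finset.mul_sum]
    simp only [C_mul, mul_assoc]
  choose c hc using hR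
  let W : Type := Fin t → Option (Fin f.vars.card)
  let c₃ : A → Multiset (A × Fin (t + 1)) := fibre (Fin (t + 1))
  let c₂ : A × Fin (t + 1) → Multiset ((A × Fin (t + 1)) × W) := fibre W
  let c₁ : (A × Fin (t + 1)) × W → Multiset (((A × Fin (t + 1)) × W) × Fin (t + 1)) :=
    fibre (Fin (t + 1))
  let leaf : ((A × Fin (t + 1)) × W) × Fin (t + 1) → K ⊕ σ :=
    fun q => termLabel f.vars (c q.1.1 q.1.2) q.1.2 q.2
  have hfib : ∀ {A' : Type} (a : A'), (Multiset.card (fibre (Fin (t + 1)) a) : ℝ) ≤ B := by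
    intro A' a
    simpa [card_fibre] using hB
  refine ⟨layered (Finset.univ : Finset A).val c₃ c₂ c₁ leaf, ?_, ?_, ⟨?_, ?_⟩, ?_, ?_, ?_⟩
  · refine (eval_layered_out _ _ _ _ _).trans ?_
    simp only [c₃, c₂, c₁, leaf, fibre, Multiset.map_map, Function.comp_def]
    change ∑ a : A, ∏ i, ∑ w, ∏ j, leafPoly (termLabel f.vars (c (a, i) w) w j) = _
    simp only [prod_leafPoly_termLabel, ← hc]
    conv_rhs => rw [hf, Finset.sum_multiset_map_count]
    rw [Finset.sum_subset (Finset.subset_univ s.toFinset)]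
    · refine Finset.sum_congr rfl fun a _ => ?_
      simp only [R]
      rw [Finset.prod_mul_distrib, ← map_prod, Finset.prod_ite_eq' Finset.univ 0]
      simp [nsmul_eq_mul]
    · intro a _ ha
      rw [Multiset.mem_toFinset] at ha
      simp [Multiset.count_eq_zero_of_notMem ha]
  · refine isDepthFour_layered _ _ _ _ _ ?_ (fibre_ne_zero (Fin (t + 1))) (fibre_ne_zero W)
      (fibre_ne_zero (Fin (t + 1)))
    rw [← Multiset.card_pos]
    exact Fintype.card_pos
  · exact fanOut_layered_top _ _ _ _ _
  · rintro (_ | a | a | a | a) h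
    · exact absurd rfl h
    · exact (fanOut_layered_lvl3 _ _ _ _ _ a).trans
        (@Multiset.count_eq_one_of_mem _ (_) _ _ Finset.univ.nodup (Finset.mem_univ a))
    · exact (fanOut_layered_lvl2 _ _ _ _ _ a).trans (sum_count_fibre a)
    · exact (fanOut_layered_lvl1 _ _ _ _ _ a).trans (sum_count_fibre a)
    · exact (fanOut_layered_lvl0 _ _ _ _ _ a).trans (sum_count_fibre a)
  · exact varsIn_layered _ _ _ _ _ fun q x h => mem_of_termLabel_eq h
  · refine mulFanInLE_layered _ _ _ _ _ (fun a => ?_) fun a => ?_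
    · exact hfib a
    · exact hfib a
  · rw [size_layered]
    simp [A, W]

end ArithCircuit

end FromDecomposition

/-! ### Numerical bounds and the permanent. -/

section Bounds

open MvPolynomial

theorem Polynomial.exists_eval_le_pow (p : Polynomial ℕ) : ∃ k : ℕ, ∀ n, 2 ≤ n → p.eval n ≤ n ^ k := by
  induction p using Polynomial.induction_on' with
  | add p q hp hq =>
    obtain ⟨k, hk⟩ := hp
    obtain ⟨l, hl⟩ := hq
    refine ⟨k + l + 1, fun n hn => ?_⟩
    have h1 : n ^ k ≤ n ^ (k + l) := Nat.pow_le_pow_right (by omega) (by omega)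
    have h2 : n ^ l ≤ n ^ (k + l) := Nat.pow_le_pow_right (by omega) (by omega)
    have h3 : n ^ (k + l) * 2 ≤ n ^ (k + l + 1) := by
      rw [pow_succ]
      exact Nat.mul_le_mul_left _ hn
    have := hk n hn
    have := hl n hn
    rw [Polynomial.eval_add]
    omega
  | monomial i a =>
    refine ⟨a + i, fun n hn => ?_⟩
    rw [Polynomial.eval_monomial, pow_add]
    exact Nat.mul_le_mul_right _ (Nat.lt_two_pow_self.le.trans (Nat.pow_le_pow_left hn a))

/-- For `d ≥ 2` one has `log d ≥ 1/2`, so the logarithm is only slack; the summand `1` covers `d =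
0` and `d = 1`, where it vanishes. -/
theorem natSqrt_three_mul_add_one_le (d : ℕ) :
    (Nat.sqrt (3 * d) : ℝ) + 1 ≤ 4 * (1 + Real.sqrt d * Real.log d) := by
  rcases Nat.lt_or_ge d 2 with hd | hd
  · interval_cases d <;> norm_num
  have h1 : (Nat.sqrt (3 * d) : ℝ) ≤ Real.sqrt 3 * Real.sqrt d := by
    rw [← Real.sqrt_mul (by norm_num)]
    exact_mod_cast Real.nat_sqrt_le_real_sqrt (a := 3 * d)
  have h2 : Real.sqrt 3 ≤ 2 := by
    rw [Real.sqrt_le_left (by norm_num)]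
    norm_num
  have h3 : (1 / 2 : ℝ) ≤ Real.log d := by
    have h := Real.log_two_gt_d9
    have : Real.log 2 ≤ Real.log d := Real.log_le_log (by norm_num) (by exact_mod_cast hd)
    linarith
  have h4 := Real.sqrt_nonneg (d : ℝ)
  nlinarith [mul_le_mul_of_nonneg_right h2 h4, mul_le_mul_of_nonneg_left h3 h4]

/-- A power of `n` whose exponent is linear in `√(3d)`, in the form used for the size bounds. -/
theorem natCast_le_rpow_of_le_pow {n d m b : ℕ} (hn : 2 ≤ n)
    (h : m ≤ n ^ (b * (Nat.sqrt (3 * d) + 1))) :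
    (m : ℝ) ≤ (n : ℝ) ^ ((4 * b : ℝ) * (1 + Real.sqrt d * Real.log d)) := by
  have hn1 : (1 : ℝ) ≤ n := by exact_mod_cast (by omega : 1 ≤ n)
  have h' : (m : ℝ) ≤ (n : ℝ) ^ (b * (Nat.sqrt (3 * d) + 1)) := by exact_mod_cast h
  refine h'.trans ?_
  rw [← Real.rpow_natCast]
  refine Real.rpow_le_rpow_of_exponent_le hn1 ?_
  push_cast
  have := mul_le_mul_of_nonneg_left (natSqrt_three_mul_add_one_le d) (Nat.cast_nonneg (α := ℝ) b)
  linarith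

theorem numMul_bound {n b t N v : ℕ} (hn : 2 ≤ n) (hN : N ≤ n ^ b) (hv : v ≤ n ^ b) :
    N ^ (t + 1) + N * v ^ t ≤ n ^ ((b + 1) * (t + 1)) := by
  have h1 : N ^ (t + 1) ≤ (n ^ b) ^ (t + 1) := Nat.pow_le_pow_left hN _
  have h2 : N * v ^ t ≤ (n ^ b) ^ (t + 1) := by
    rw [pow_succ']
    exact Nat.mul_le_mul hN (Nat.pow_le_pow_left hv _)
  have h3 : (n ^ b) ^ (t + 1) * 2 ≤ n ^ ((b + 1) * (t + 1)) := by
    have he : n ^ ((b + 1) * (t + 1)) = (n ^ b) ^ (t + 1) * n ^ (t + 1) := by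
      rw [add_mul, pow_add, one_mul, pow_mul]
    rw [he]
    exact Nat.mul_le_mul_left _ (hn.trans (Nat.le_self_pow (by omega) n))
  omega

/-- Each of the five summands is at most `x ^ (3 * (t + 1))` with `x = n ^ b`, and `5 ≤ 8 ≤ n ^ 3`.
-/
theorem size_bound {n b t N v : ℕ} (hn : 2 ≤ n) (hN : N ≤ n ^ b) (hv : v ≤ n ^ b)
    (ht : t + 1 ≤ n ^ b) :
    1 + (N ^ (t + 1) + (N ^ (t + 1) * (t + 1) + (N ^ (t + 1) * (t + 1) * v ^ t +
      N ^ (t + 1) * (t + 1) * v ^ t * (t + 1)))) ≤ n ^ ((3 * b + 3) * (t + 1)) := by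
  set x := n ^ b with hx
  have hx1 : 1 ≤ x := Nat.one_le_pow _ _ (by omega)
  have h1 : N ^ (t + 1) ≤ x ^ (t + 1) := Nat.pow_le_pow_left hN _
  have h2 : N ^ (t + 1) * (t + 1) ≤ x ^ (t + 1) * x := Nat.mul_le_mul h1 ht
  have h3 : N ^ (t + 1) * (t + 1) * v ^ t ≤ x ^ (t + 1) * x * x ^ t :=
    Nat.mul_le_mul h2 (Nat.pow_le_pow_left hv _)
  have h4 : N ^ (t + 1) * (t + 1) * v ^ t * (t + 1) ≤ x ^ (t + 1) * x * x ^ t * x :=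
    Nat.mul_le_mul h3 ht
  have e1 : x ^ (t + 1) ≤ x ^ (3 * (t + 1)) := Nat.pow_le_pow_right hx1 (by omega)
  have e2 : x ^ (t + 1) * x ≤ x ^ (3 * (t + 1)) := by
    rw [← pow_succ]
    exact Nat.pow_le_pow_right hx1 (by omega)
  have e3 : x ^ (t + 1) * x * x ^ t ≤ x ^ (3 * (t + 1)) := by
    rw [← pow_succ, ← pow_add]
    exact Nat.pow_le_pow_right hx1 (by omega)
  have e4 : x ^ (t + 1) * x * x ^ t * x ≤ x ^ (3 * (t + 1)) := by
    rw [← pow_succ, ← pow_add, ← pow_succ]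
    exact Nat.pow_le_pow_right hx1 (by omega)
  have e0 : 1 ≤ x ^ (3 * (t + 1)) := Nat.one_le_pow _ _ hx1
  have e5 : x ^ (3 * (t + 1)) * 8 ≤ n ^ ((3 * b + 3) * (t + 1)) := by
    rw [hx, ← pow_mul, show (3 * b + 3) * (t + 1) = b * (3 * (t + 1)) + 3 * (t + 1) by ring, pow_add]
    refine Nat.mul_le_mul_left _ ?_
    calc 8 = 2 ^ 3 := by norm_num
      _ ≤ n ^ 3 := Nat.pow_le_pow_left hn 3
      _ ≤ n ^ (3 * (t + 1)) := Nat.pow_le_pow_right (by omega) (by omega)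
  omega

/-- From `3d < (t + 1)²` in integers comes `3d ≤ t² + 2t`: just enough for `t + 1` factors. -/
theorem natSqrt_three_mul_spec (d : ℕ) :
    (d ≤ Nat.sqrt (3 * d) ∨ 1 ≤ Nat.sqrt (3 * d)) ∧
      3 * d ≤ (Nat.sqrt (3 * d) + 2) * Nat.sqrt (3 * d) := by
  have h := Nat.lt_succ_sqrt (3 * d)
  constructor
  · by_contra! hcon
    have h0 : Nat.sqrt (3 * d) = 0 := by omega
    rw [h0] at h
    omega
  · rw [Nat.succ_eq_add_one] at h
    nlinarith

theorem natSqrt_three_mul_le (d : ℕ) : (Nat.sqrt (3 * d) : ℝ) + 1 ≤ Real.sqrt (3 * (d : ℝ)) + 1 := by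
  have := Real.nat_sqrt_le_real_sqrt (a := 3 * d)
  push_cast at this
  linarith

namespace ArithCircuit

variable {K : Type u} {σ : Type v} [CommSemiring K]

theorem exists_depthFour_circuit (C : ArithCircuit K σ) (hC : C.IsBinary) {f : MvPolynomial σ K}
    (hf : C.Computes f) :
    ∃ Γ : ArithCircuit K σ, (Γ.Computes f ∧ Γ.IsDepthFour ∧ Γ.InputsUnshared ∧
      Γ.VarsIn {x | x ∈ f.vars} ∧
      Γ.MulFanInLE (Real.sqrt (3 * (f.totalDegree : ℝ)) + 1)) ∧
      ∃ N v, N ≤ (C.size * (f.totalDegree + 1) + 2) ^ 3 ∧ v ≤ C.size + 1 ∧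
      Γ.numAdd ≤ 1 + N ∧
      Γ.numMul ≤ N ^ (Nat.sqrt (3 * f.totalDegree) + 1) + N * v ^ Nat.sqrt (3 * f.totalDegree) := by
  obtain ⟨ht, hdt⟩ := natSqrt_three_mul_spec f.totalDegree
  obtain ⟨P, hdeg, hvars, s, hs, hsum⟩ := C.exists_decomposition hC hf ht hdt
  obtain ⟨Γ, h1, h2, h3, h4, h5, h6, h7⟩ :=
    exists_circuit_of_decomposition P hdeg hvars s hs hsum (natSqrt_three_mul_le _)
  exact ⟨Γ, ⟨h1, h2, h3, h4, h5⟩, _, _, C.card_familyIndex_le _,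
    Nat.add_le_add_right (C.card_vars_le_size hf) 1, h6, h7⟩

theorem exists_depthFour_formula (C : ArithCircuit K σ) (hC : C.IsBinary) {f : MvPolynomial σ K}
    (hf : C.Computes f) :
    ∃ F : ArithCircuit K σ, (F.Computes f ∧ F.IsDepthFour ∧ F.IsFormula ∧
      F.VarsIn {x | x ∈ f.vars} ∧
      F.MulFanInLE (Real.sqrt (3 * (f.totalDegree : ℝ)) + 1)) ∧
      ∃ N v t, N ≤ (C.size * (f.totalDegree + 1) + 2) ^ 3 ∧ v ≤ C.size + 1 ∧
      t = Nat.sqrt (3 * f.totalDegree) ∧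
      F.size = 1 + (N ^ (t + 1) + (N ^ (t + 1) * (t + 1) + (N ^ (t + 1) * (t + 1) * v ^ t +
        N ^ (t + 1) * (t + 1) * v ^ t * (t + 1)))) := by
  obtain ⟨ht, hdt⟩ := natSqrt_three_mul_spec f.totalDegree
  obtain ⟨P, hdeg, hvars, s, -, hsum⟩ := C.exists_decomposition hC hf ht hdt
  obtain ⟨F, h1, h2, h3, h4, h5, h6⟩ :=
    exists_formula_of_decomposition P hdeg hvars s hsum (natSqrt_three_mul_le _)
  exact ⟨F, ⟨h1, h2, h3, h4, h5⟩, _, _, _, C.card_familyIndex_le _,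
    Nat.add_le_add_right (C.card_vars_le_size hf) 1, rfl, h6⟩

end ArithCircuit

variable {K : Type u} [Field K] {σ : ℕ → Type v} {f : ∀ n, MvPolynomial (σ n) K}

/-- All quantities entering the size bounds are bounded by one power of `n`. -/
theorem IsVP.exists_circuits (hf : IsVP f) :
    ∃ C : ∀ n, ArithCircuit K (σ n), (∀ n, (C n).IsBinary ∧ (C n).Computes (f n)) ∧
      ∃ b : ℕ, ∀ n, 2 ≤ n → ((C n).size * ((f n).totalDegree + 1) + 2) ^ 3 ≤ n ^ b ∧
        (C n).size + 1 ≤ n ^ b ∧ Nat.sqrt (3 * (f n).totalDegree) + 1 ≤ n ^ b := by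
  obtain ⟨⟨p, hp⟩, q, hq⟩ := hf
  choose C hbin hcomp hsize using hq
  refine ⟨C, fun n => ⟨hbin n, hcomp n⟩, ?_⟩
  obtain ⟨k, hk⟩ := p.exists_eval_le_pow
  obtain ⟨l, hl⟩ := q.exists_eval_le_pow
  refine ⟨3 * (k + l + 2), fun n hn => ?_⟩
  have hd := (hp n).trans (hk n hn)
  have hs := (hsize n).trans (hl n hn)
  generalize (f n).totalDegree = d at *
  generalize (C n).size = s at *
  have hk1 : 1 ≤ n ^ k := Nat.one_le_pow _ _ (by omega)
  have hl1 : 1 ≤ n ^ l := Nat.one_le_pow _ _ (by omega)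
  have hd' : d + 1 ≤ n ^ k * n := by nlinarith
  have hmul : s * (d + 1) ≤ n ^ l * (n ^ k * n) := Nat.mul_le_mul hs hd'
  have hbase : s * (d + 1) + 2 ≤ n ^ (k + l + 2) := by
    have hle : n ≤ n ^ l * (n ^ k * n) := by
      have := Nat.mul_le_mul hl1 (Nat.mul_le_mul hk1 (le_refl n))
      omega
    have : n ^ (k + l + 2) = n ^ l * (n ^ k * n) * n := by ring
    rw [this]
    nlinarith
  have hpow : n ^ (k + l + 2) ≤ n ^ (3 * (k + l + 2)) :=
    Nat.pow_le_pow_right (by omega) (by omega)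
  refine ⟨?_, ?_, ?_⟩
  · rw [mul_comm 3, pow_mul]
    exact Nat.pow_le_pow_left hbase 3
  · have : s ≤ s * (d + 1) := Nat.le_mul_of_pos_right s (by omega)
    omega
  · have h1 : n ^ (k + 2) ≤ n ^ (3 * (k + l + 2)) :=
      Nat.pow_le_pow_right (by omega) (by omega)
    have h2 : n ^ (k + 2) = n ^ k * (n * n) := by ring
    have h3 : 4 ≤ n * n := Nat.mul_le_mul hn hn
    have h4 : n ^ k * 4 ≤ n ^ k * (n * n) := Nat.mul_le_mul_left _ h3
    have := Nat.sqrt_le_self (3 * d)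
    omega

theorem IsVP.exists_depthFour_circuits (hf : IsVP f) :
    ∃ Γ : ∀ n, ArithCircuit K (σ n),
      (∀ n, (Γ n).Computes (f n) ∧ (Γ n).IsDepthFour ∧ (Γ n).InputsUnshared ∧
        (Γ n).VarsIn {x | x ∈ (f n).vars} ∧
        (Γ n).MulFanInLE (Real.sqrt (3 * ((f n).totalDegree : ℝ)) + 1)) ∧
      ∃ c : ℝ, ∀ n : ℕ, 2 ≤ n →
        ((Γ n).numAdd : ℝ) ≤ (n : ℝ) ^ (c * (1 + Real.log ((f n).totalDegree : ℝ))) ∧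
        ((Γ n).numMul : ℝ) ≤
          (n : ℝ) ^ (c * (1 + Real.sqrt ((f n).totalDegree : ℝ) *
            Real.log ((f n).totalDegree : ℝ))) := by
  obtain ⟨C, hC, b, hb⟩ := hf.exists_circuits
  choose Γ hΓ hbound using fun n => (C n).exists_depthFour_circuit (hC n).1 (hC n).2
  refine ⟨Γ, hΓ, 4 * (b + 1 : ℕ), fun n hn => ?_⟩
  obtain ⟨N, v, hN, hv, hadd, hmul⟩ := hbound n
  obtain ⟨hb1, hb2, -⟩ := hb n hn
  refine ⟨?_, natCast_le_rpow_of_le_pow hn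
    (hmul.trans (numMul_bound hn (hN.trans hb1) (hv.trans hb2)))⟩
  have hn1 : (1 : ℝ) ≤ n := by exact_mod_cast (by omega : 1 ≤ n)
  -- The number of addition gates is polynomial outright; the term `log d` only adds slack.
  have h1 : (Γ n).numAdd ≤ n ^ (b + 1) := by
    have h0 : 1 ≤ n ^ b := Nat.one_le_pow _ _ (by omega)
    have h2 : n ^ b * 2 ≤ n ^ (b + 1) := by
      rw [pow_succ]
      exact Nat.mul_le_mul_left _ hn
    omega
  have h2 : ((Γ n).numAdd : ℝ) ≤ (n : ℝ) ^ (b + 1) := by exact_mod_cast h1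
  refine h2.trans ?_
  rw [← Real.rpow_natCast]
  refine Real.rpow_le_rpow_of_exponent_le hn1 ?_
  have h3 := mul_nonneg (Nat.cast_nonneg (α := ℝ) (b + 1))
    (Real.log_natCast_nonneg (f n).totalDegree)
  have h4 := Nat.cast_nonneg (α := ℝ) (b + 1)
  linarith

/-- The sign of `c` is recorded so that the exponent can be enlarged for the permanent. -/
theorem IsVP.exists_depthFour_formulas (hf : IsVP f) :
    ∃ F : ∀ n, ArithCircuit K (σ n),
      (∀ n, (F n).Computes (f n) ∧ (F n).IsDepthFour ∧ (F n).IsFormula ∧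
        (F n).VarsIn {x | x ∈ (f n).vars} ∧
        (F n).MulFanInLE (Real.sqrt (3 * ((f n).totalDegree : ℝ)) + 1)) ∧
      ∃ c : ℝ, 0 ≤ c ∧ ∀ n : ℕ, 2 ≤ n →
        ((F n).size : ℝ) ≤
          (n : ℝ) ^ (c * (1 + Real.sqrt ((f n).totalDegree : ℝ) *
            Real.log ((f n).totalDegree : ℝ))) := by
  obtain ⟨C, hC, b, hb⟩ := hf.exists_circuits
  choose F hF hbound using fun n => (C n).exists_depthFour_formula (hC n).1 (hC n).2
  refine ⟨F, hF, 4 * (3 * b + 3 : ℕ), by positivity, fun n hn => ?_⟩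
  obtain ⟨N, v, t, hN, hv, rfl, hsize⟩ := hbound n
  obtain ⟨hb1, hb2, hb3⟩ := hb n hn
  refine natCast_le_rpow_of_le_pow hn ?_
  rw [hsize]
  exact size_bound hn (hN.trans hb1) (hv.trans hb2) hb3

theorem totalDegree_permanentPoly_le (K : Type u) [Field K] (n : ℕ) :
    (permanentPoly K n).totalDegree ≤ n := by
  rw [permanentPoly, Matrix.permanent]
  refine totalDegree_finsetSum_le fun τ _ => ?_
  refine (totalDegree_finsetProd _ _).trans ?_
  refine (Finset.sum_le_card_nsmul _ _ 1 fun i _ => ?_).trans (by simp)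
  rw [Matrix.of_apply]
  exact (isHomogeneous_X K _).totalDegree_le

theorem isVP_permanentPoly (K : Type u) [Field K] (h : HasPolySizeCircuits (permanentPoly K)) :
    IsVP (permanentPoly K) :=
  ⟨⟨Polynomial.X, fun n => by simpa using totalDegree_permanentPoly_le K n⟩, h⟩

/-- The `1` is absorbed by `2 * log 2 > 1`, so only an upper bound on the degree of the permanent is
needed. -/
theorem one_add_sqrt_mul_log_le {d n : ℕ} (hn : 2 ≤ n) (hd : d ≤ n) :
    1 + Real.sqrt d * Real.log d ≤ 3 * (Real.sqrt n * Real.log n) := by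
  have hlog2 := Real.log_two_gt_d9
  have hlog : Real.log 2 ≤ Real.log n := Real.log_le_log (by norm_num) (by exact_mod_cast hn)
  have hsqrt : 1 ≤ Real.sqrt n := by
    rw [Real.one_le_sqrt]
    exact_mod_cast (by omega : 1 ≤ n)
  have h1 : Real.sqrt d * Real.log d ≤ Real.sqrt n * Real.log n := by
    refine mul_le_mul (Real.sqrt_le_sqrt (by exact_mod_cast hd)) ?_
      (Real.log_natCast_nonneg d) (Real.sqrt_nonneg _)
    rcases Nat.eq_zero_or_pos d with rfl | hd0
    · simpa using Real.log_natCast_nonneg n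
    · exact Real.log_le_log (by exact_mod_cast hd0) (by exact_mod_cast hd)
  nlinarith

end Bounds

theorem theorem5 (K : Type u) [Field K] :
    (∀ (σ : ℕ → Type v) (f : ∀ n, MvPolynomial (σ n) K), IsVP f →
      (∃ Γ : ∀ n, ArithCircuit K (σ n),
        (∀ n, (Γ n).Computes (f n) ∧ (Γ n).IsDepthFour ∧ (Γ n).InputsUnshared ∧
          (Γ n).VarsIn {x | x ∈ (f n).vars} ∧
          (Γ n).MulFanInLE (Real.sqrt (3 * ((f n).totalDegree : ℝ)) + 1)) ∧
        ∃ c : ℝ, ∀ n : ℕ, 2 ≤ n →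
          ((Γ n).numAdd : ℝ) ≤ (n : ℝ) ^ (c * (1 + Real.log ((f n).totalDegree : ℝ))) ∧
          ((Γ n).numMul : ℝ) ≤
            (n : ℝ) ^ (c * (1 + Real.sqrt ((f n).totalDegree : ℝ) *
              Real.log ((f n).totalDegree : ℝ)))) ∧
      (∃ F : ∀ n, ArithCircuit K (σ n),
        (∀ n, (F n).Computes (f n) ∧ (F n).IsDepthFour ∧ (F n).IsFormula ∧
          (F n).VarsIn {x | x ∈ (f n).vars} ∧
          (F n).MulFanInLE (Real.sqrt (3 * ((f n).totalDegree : ℝ)) + 1)) ∧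
        ∃ c : ℝ, ∀ n : ℕ, 2 ≤ n →
          ((F n).size : ℝ) ≤
            (n : ℝ) ^ (c * (1 + Real.sqrt ((f n).totalDegree : ℝ) *
              Real.log ((f n).totalDegree : ℝ))))) ∧
    (HasPolySizeCircuits (permanentPoly K) →
      ∃ F : ∀ n, ArithCircuit K (Fin n × Fin n),
        (∀ n, (F n).Computes (permanentPoly K n) ∧ (F n).IsDepthFour ∧ (F n).IsFormula) ∧
        ∃ c : ℝ, ∀ n : ℕ, 2 ≤ n →
          ((F n).size : ℝ) ≤ (n : ℝ) ^ (c * (Real.sqrt (n : ℝ) * Real.log (n : ℝ)))) := by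
  refine ⟨fun σ f hf => ⟨hf.exists_depthFour_circuits, ?_⟩, fun h => ?_⟩
  · obtain ⟨F, hF, c, -, hc⟩ := hf.exists_depthFour_formulas
    exact ⟨F, hF, c, hc⟩
  · obtain ⟨F, hF, c, hc0, hc⟩ := (isVP_permanentPoly K h).exists_depthFour_formulas
    refine ⟨F, fun n => ⟨(hF n).1, (hF n).2.1, (hF n).2.2.1⟩, c * 3, fun n hn => ?_⟩
    refine (hc n hn).trans (Real.rpow_le_rpow_of_exponent_le ?_ ?_)
    · exact_mod_cast (by omega : 1 ≤ n)
    · rw [mul_assoc]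
      exact mul_le_mul_of_nonneg_left
        (one_add_sqrt_mul_log_le hn (totalDegree_permanentPoly_le K n)) hc0
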